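/- Let $\Sigma=\{a,b\}$ be a binary alphabet. A finite word $w$ over $\Sigma$ is \emph{closed} if it is empty or has a factor $v\neq w$ that occurs exactly twice in $w$, as a prefix and as a suffix (with no internal occurrences); otherwise it is \emph{open}. The \emph{oc-sequence} $\mathrm{oc}(w)$ of a finite word $w$ is the binary word of length $|w|$ whose $i$-th letter, $1\le i\le |w|$, is $1$ if the prefix of $w$ of length $i$ is closed and $0$ if it is open. An infinite word over $\Sigma$ is \emph{Sturmian} if it has exactly $m+1$ distinct factors of length $m$ for every $m\ge 0$; a Sturmian word $s$ is \emph{standard} if $as$ and $bs$ are both Sturmian. Let $w$ be a finite word over $\Sigma$ such that \[\mathrm{oc}(w)=1^{k_0}0^{k'_0}1^{k_1}0^{k'_1}\cdots 1^{k_n}0^{k'_n}1\] for some $n\ge 0$ and positive integers $k_0,k'_0,\ldots,k_n,k'_n$. Then $w$ is a prefix of some standard Sturmian word if and only if $k_j=k'_j$ for every $0\le j\le n$. -/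

import Mathlib

/-- A finite word `w` is closed if it is empty or has a factor `v ≠ w` that is both a prefix and a
suffix of `w` and has no internal occurrence in `w`. -/
def IsClosedWord {A : Type*} (w : List A) : Prop :=
  w = [] ∨ ∃ v : List A, v ≠ w ∧ v <+: w ∧ v <:+ w ∧
    ∀ p q : List A, w = p ++ v ++ q → p = [] ∨ q = []

open Classical in
/-- The oc-sequence of a finite word `w`: a binary word of length `|w|` whose entry at (1-based)
position `i` is `1` if the prefix of `w` of length `i` is closed and `0` if it is open. -/
noncomputable def ocSeq {A : Type*} (w : List A) : List (Fin 2) :=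
  (List.range w.length).map fun i => if IsClosedWord (w.take (i + 1)) then 1 else 0

/-- The set of factors of length `n` of an infinite word. -/
def factorsOfLength {A : Type*} (s : Stream' A) (n : ℕ) : Set (List A) :=
  {u | ∃ i : ℕ, u = (s.drop i).take n}

/-- An infinite word over the binary alphabet is Sturmian if it has exactly `n + 1` distinct factors
of length `n`, for every `n ≥ 0`. -/
def IsSturmian (s : Stream' Bool) : Prop :=
  ∀ n : ℕ, (factorsOfLength s n).ncard = n + 1

/-- A Sturmian word `s` is standard if the words obtained by prepending either letter to `s` are
both Sturmian. -/
def IsStandardSturmian (s : Stream' Bool) : Prop :=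
  IsSturmian s ∧ IsSturmian (Stream'.cons false s) ∧ IsSturmian (Stream'.cons true s)

/-- The finite word `w` is a prefix of the infinite word `s`. -/
def IsPrefixOfInfinite {A : Type*} (w : List A) (s : Stream' A) : Prop :=
  w = s.take w.length

/-! A nonempty prefix is closed exactly when its length is l + j, with j the first return of the
prefix of length l (`isClosedWord_take_iff`). First returns grow weakly with l, so at a 1 of the
oc-sequence l counts the earlier ones and j - 1 the earlier zeros (`isFirstReturn_of_ocSeq`). If K,
K' are the sums of the k_i, k'_i up to a given block, that block ends in a jump: length K - 1
returns before length K does, and length K returns at K' + 1.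

In a standard word such a jump forces the return K + 1 (`IsStandardSturmian.firstReturn_eq`),
because the windows of length K before the return list each of the K + 1 factors once. So all
partial sums agree, hence so do the exponents.

Conversely, equality of the total sums suffices: the last jump gives w the period q = K + 1 and a
prefix of it an older period p, and by Fine and Wilf the letters before positions p and q differ
(`IsFirstReturn.get_ne`). Replacing (p, q) by (q, p + q) repeatedly gives, in the limit, a standard
word (`IsCentralPair.exists_standard`). -/

/-- The factor of length `m` of the infinite word `s` starting at position `i`. -/
def factorAt {A : Type*} (s : Stream' A) (i m : ℕ) : List A := (s.drop i).take m

lemma length_factorAt {A : Type*} (s : Stream' A) (i m : ℕ) : (factorAt s i m).length = m :=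
  Stream'.length_take _ _

lemma factorAt_succ {A : Type*} (s : Stream' A) (i m : ℕ) :
    factorAt s i (m + 1) = s.get i :: factorAt s (i + 1) m := by
  simp [factorAt, Stream'.take_succ]

lemma getElem?_factorAt {A : Type*} (s : Stream' A) {i m k : ℕ} (h : k < m) :
    (factorAt s i m)[k]? = some (s.get (i + k)) := by
  rw [factorAt, Stream'.getElem?_take h, Stream'.get_drop]

lemma factorAt_eq_iff {A : Type*} (s t : Stream' A) (i j m : ℕ) :
    factorAt s i m = factorAt t j m ↔ ∀ k < m, s.get (i + k) = t.get (j + k) := by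
  constructor
  · intro h k hk
    have := congrArg (fun l : List A => l[k]?) h
    simpa [getElem?_factorAt _ hk] using this
  · intro h
    apply List.ext_getElem?
    intro k
    by_cases hk : k < m
    · rw [getElem?_factorAt _ hk, getElem?_factorAt _ hk, h k hk]
    · rw [List.getElem?_eq_none, List.getElem?_eq_none] <;> rw [length_factorAt] <;> omega

lemma factorAt_add {A : Type*} (s : Stream' A) (i a b : ℕ) :
    factorAt s i (a + b) = factorAt s i a ++ factorAt s (i + a) b := by
  induction a generalizing i with
  | zero => simp [factorAt]
  | succ a ih =>
    rw [Nat.add_right_comm, factorAt_succ, ih, factorAt_succ, Nat.add_right_comm i 1 a]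
    simp [Nat.add_assoc]

lemma take_eq_factorAt {A : Type*} (s : Stream' A) (m : ℕ) : s.take m = factorAt s 0 m := by
  simp [factorAt]

lemma dropLast_factorAt {A : Type*} (s : Stream' A) (i m : ℕ) :
    (factorAt s i (m + 1)).dropLast = factorAt s i m := by
  simp [factorAt]

lemma factorAt_mem {A : Type*} (s : Stream' A) (i m : ℕ) :
    factorAt s i m ∈ factorsOfLength s m := ⟨i, rfl⟩

lemma finite_factorsOfLength (s : Stream' Bool) (m : ℕ) : (factorsOfLength s m).Finite := by
  apply (List.finite_length_eq Bool m).subset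
  rintro _ ⟨i, rfl⟩
  exact length_factorAt s i m

/-! ### First returns and closed prefixes. -/

/-- The position `j` is the first one after `0` at which the prefix of length `l` of `s` reoccurs. -/
def IsFirstReturn {A : Type*} (s : Stream' A) (l j : ℕ) : Prop :=
  0 < j ∧ factorAt s j l = factorAt s 0 l ∧
    ∀ i, 0 < i → i < j → factorAt s i l ≠ factorAt s 0 l

lemma factorAt_eq_of_le {A : Type*} {s t : Stream' A} {i j l m : ℕ} (hlm : l ≤ m)
    (h : factorAt s i m = factorAt t j m) : factorAt s i l = factorAt t j l := by
  rw [factorAt_eq_iff] at h ⊢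
  exact fun k hk => h k (by omega)

lemma IsFirstReturn.le_of_eq {A : Type*} {s : Stream' A} {l j i : ℕ} (h : IsFirstReturn s l j)
    (hi : 0 < i) (heq : factorAt s i l = factorAt s 0 l) : j ≤ i := by
  by_contra hlt
  exact h.2.2 i hi (by omega) heq

lemma IsFirstReturn.mono {A : Type*} {s : Stream' A} {l l' j j' : ℕ} (h : IsFirstReturn s l j)
    (h' : IsFirstReturn s l' j') (hl : l ≤ l') : j ≤ j' :=
  h.le_of_eq h'.1 (factorAt_eq_of_le hl h'.2.1)

lemma IsFirstReturn.exists_of_le {A : Type*} {s : Stream' A} {l l' j : ℕ}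
    (h : IsFirstReturn s l j) (hl : l' ≤ l) : ∃ j', IsFirstReturn s l' j' := by
  classical
  have hex : ∃ i, 0 < i ∧ factorAt s i l' = factorAt s 0 l' :=
    ⟨j, h.1, factorAt_eq_of_le hl h.2.1⟩
  refine ⟨Nat.find hex, (Nat.find_spec hex).1, (Nat.find_spec hex).2, fun i hi hlt heq => ?_⟩
  exact Nat.find_min hex hlt ⟨hi, heq⟩

lemma isFirstReturn_zero {A : Type*} (s : Stream' A) : IsFirstReturn s 0 1 :=
  ⟨one_pos, by simp [factorAt], fun i h h' => by omega⟩

/-- A nonempty prefix is closed exactly when its length is `l + j`, with `j` the first return of the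
prefix of length `l`. -/
lemma isClosedWord_take_iff {A : Type*} (s : Stream' A) {m : ℕ} (hm : 0 < m) :
    IsClosedWord (s.take m) ↔ ∃ l j, l + j = m ∧ IsFirstReturn s l j := by
  rw [take_eq_factorAt]
  constructor
  · rintro (h | ⟨v, hne, hpre, hsuf, hint⟩)
    · have := congrArg List.length h
      rw [length_factorAt] at this
      simp at this
      omega
    · have hlen : v.length ≤ m := by simpa [length_factorAt] using hpre.length_le
      have hv : v = factorAt s 0 v.length := by
        obtain ⟨c, hc⟩ := hpre
        obtain ⟨d, rfl⟩ := Nat.exists_eq_add_of_le hlen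
        rw [factorAt_add] at hc
        exact (List.append_inj hc (by rw [length_factorAt])).1
      have hlt : v.length < m := by
        rcases hlen.lt_or_eq with h | h
        · exact h
        · exact absurd (h ▸ hv) hne
      obtain ⟨j, rfl⟩ := Nat.exists_eq_add_of_le hlen
      refine ⟨v.length, j, rfl, by omega, ?_, ?_⟩
      · obtain ⟨c, hc⟩ := hsuf
        rw [Nat.add_comm, factorAt_add] at hc
        have := (List.append_inj' hc (by rw [length_factorAt])).2
        rw [Nat.zero_add] at this
        rw [← this, ← hv]
      · intro i hi hij heq
        obtain ⟨d, rfl⟩ := Nat.exists_eq_add_of_lt hij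
        have := hint (factorAt s 0 i) (factorAt s (i + v.length) (d + 1)) (by
          have e : v.length + (i + d + 1) = i + v.length + (d + 1) := by omega
          rw [e, factorAt_add, factorAt_add, Nat.zero_add, Nat.zero_add, heq, ← hv])
        rcases this with h | h <;>
        · have := congrArg List.length h
          simp only [length_factorAt, List.length_nil] at this
          omega
  · rintro ⟨l, j, rfl, hj, heq, hmin⟩
    refine Or.inr ⟨factorAt s 0 l, ?_, ?_, ?_, ?_⟩
    · intro h
      have := congrArg List.length h
      rw [length_factorAt, length_factorAt] at this
      omega
    · exact ⟨_, (factorAt_add s 0 l j).symm⟩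
    · refine ⟨factorAt s 0 j, ?_⟩
      rw [Nat.add_comm l j, factorAt_add, Nat.zero_add, heq]
    · intro p q hpq
      by_contra! hne
      have hp := List.length_pos_iff.2 hne.1
      have hq := List.length_pos_iff.2 hne.2
      have hlen := congrArg List.length hpq
      simp only [List.length_append, length_factorAt] at hlen
      apply hmin p.length hp (by omega)
      have e : l + j = p.length + l + q.length := by omega
      rw [e, factorAt_add, factorAt_add, Nat.zero_add] at hpq
      have := (List.append_inj hpq (by simp [length_factorAt])).1
      exact (List.append_inj this (by simp [length_factorAt])).2

open Classical in
/-- A first return of the prefix of length `l` completes the closed prefix number `l`. -/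
lemma IsFirstReturn.count_eq {A : Type*} {s : Stream' A} {l j : ℕ} (h : IsFirstReturn s l j) :
    Nat.count (fun i => IsClosedWord (s.take (i + 1))) (l + j - 1) = l := by
  induction l generalizing j with
  | zero =>
    have : j = 1 := le_antisymm (h.mono (isFirstReturn_zero s) le_rfl) h.1
    subst this
    simp
  | succ l ih =>
    obtain ⟨j₀, h₀⟩ := h.exists_of_le (Nat.le_succ l)
    have hle := h₀.mono h (Nat.le_succ l)
    have hpos := h₀.1
    obtain ⟨d, rfl⟩ := Nat.exists_eq_add_of_le hle
    have hc : Nat.count (fun i => IsClosedWord (s.take (i + 1))) (l + j₀ - 1 + 1) = l + 1 := by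
      rw [Nat.count_succ, ih h₀, if_pos]
      exact (isClosedWord_take_iff s (by omega)).2 ⟨l, j₀, by omega, h₀⟩
    have e : l + 1 + (j₀ + d) - 1 = (l + j₀ - 1 + 1) + d := by omega
    rw [e, Nat.count_add, hc, Nat.count_of_forall_not, Nat.add_zero]
    intro i hi hcl
    obtain ⟨l', j', hsum, h'⟩ := (isClosedWord_take_iff s (by omega)).1 hcl
    rcases Nat.lt_or_ge l l' with hl | hl
    · have := h.mono h' hl
      omega
    · have := h'.mono h₀ hl
      omega

lemma IsPrefixOfInfinite.take_eq {A : Type*} {w : List A} {s : Stream' A}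
    (h : IsPrefixOfInfinite w s) {m : ℕ} (hm : m ≤ w.length) : w.take m = s.take m := by
  conv_lhs => rw [h]
  rw [Stream'.take_take, min_eq_right hm]

lemma length_ocSeq {A : Type*} (w : List A) : (ocSeq w).length = w.length := by
  simp [ocSeq]

open Classical in
lemma count_one_take_ocSeq {A : Type*} {w : List A} {s : Stream' A}
    (h : IsPrefixOfInfinite w s) {m : ℕ} (hm : m ≤ w.length) :
    ((ocSeq w).take m).count 1 = Nat.count (fun i => IsClosedWord (s.take (i + 1))) m := by
  rw [ocSeq, ← List.map_take, List.take_range, min_eq_left hm, List.count, List.countP_map,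
    Nat.count]
  apply List.countP_congr
  intro i hi
  rw [List.mem_range] at hi
  rw [← h.take_eq (show i + 1 ≤ w.length by omega)]
  by_cases hc : IsClosedWord (w.take (i + 1)) <;> simp [hc]

/-- The letters preceding an occurrence of `1` in the oc-sequence determine a first return. -/
lemma isFirstReturn_of_ocSeq {A : Type*} {w : List A} {s : Stream' A}
    (h : IsPrefixOfInfinite w s) {u v : List (Fin 2)} (huv : ocSeq w = u ++ 1 :: v) :
    IsFirstReturn s (u.count 1) (u.count 0 + 1) := by
  have hlen : u.length < w.length := by
    rw [← length_ocSeq w, huv]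
    simp
  have hsum : u.length = u.count 1 + u.count 0 := by
    clear huv hlen
    induction u with
    | nil => simp
    | cons a u ih => fin_cases a <;> simp [ih] <;> omega
  have hclosed : IsClosedWord (s.take (u.length + 1)) := by
    rw [← h.take_eq hlen]
    have hget : (ocSeq w)[u.length]? = some 1 := by
      rw [huv]
      simp
    by_contra hc
    simp [ocSeq, hlen, hc] at hget
  obtain ⟨l, j, hlj, hr⟩ := (isClosedWord_take_iff s (by omega)).1 hclosed
  have hcount := hr.count_eq
  rw [hlj, Nat.add_sub_cancel, ← count_one_take_ocSeq h hlen.le, huv, List.take_left] at hcount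
  have : j = u.count 0 + 1 := by omega
  rwa [← this, hcount]

/-! ### Special factors of standard words. -/

/-- If there were two colliding fibres, dropping one element from each would leave a set still
covering `Y` but too small. Applied to deletion of the first or last letter, this makes special
factors unique. -/
lemma Set.apply_eq_apply_of_ncard_eq_add_one {α β : Type*} {X : Set α} {Y : Set β} (f : α → β)
    (hX : X.Finite) (hsurj : Y ⊆ f '' X) (hcard : X.ncard = Y.ncard + 1) {a a' b b' : α}
    (ha : a ∈ X) (ha' : a' ∈ X) (hb : b ∈ X) (hb' : b' ∈ X) (haa' : a ≠ a') (hbb' : b ≠ b')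
    (hfa : f a = f a') (hfb : f b = f b') : f a = f b := by
  by_contra hne
  have hsub : Y ⊆ f '' (X \ {a, b}) := by
    intro y hy
    obtain ⟨x, hx, rfl⟩ := hsurj hy
    by_cases hxa : x = a
    · subst hxa
      exact ⟨a', ⟨ha', by rintro (h | h) <;> grind⟩, hfa.symm⟩
    by_cases hxb : x = b
    · subst hxb
      exact ⟨b', ⟨hb', by rintro (h | h) <;> grind⟩, hfb.symm⟩
    exact ⟨x, ⟨hx, by simp [hxa, hxb]⟩, rfl⟩
  have hab : a ≠ b := fun h => hne (h ▸ rfl)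
  have h1 := Set.ncard_le_ncard hsub ((hX.sdiff).image f)
  have h2 := Set.ncard_image_le (f := f) (hX.sdiff (t := {a, b}))
  have h3 := Set.ncard_sdiff_add_ncard_of_subset (s := {a, b}) (t := X)
    (by rintro x (rfl | rfl) <;> assumption) hX
  rw [Set.ncard_pair hab] at h3
  omega

lemma Set.ncard_lt_ncard_of_surjOn_of_eq {α β : Type*} {X : Set α} {Y : Set β} (f : α → β)
    (hX : X.Finite) (hsurj : Y ⊆ f '' X) {a a' : α}
    (ha : a ∈ X) (ha' : a' ∈ X) (haa' : a ≠ a') (hfa : f a = f a') : Y.ncard < X.ncard := by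
  have hsub : Y ⊆ f '' (X \ {a}) := by
    intro y hy
    obtain ⟨x, hx, rfl⟩ := hsurj hy
    by_cases hxa : x = a
    · subst hxa
      exact ⟨a', ⟨ha', haa'.symm⟩, hfa.symm⟩
    exact ⟨x, ⟨hx, hxa⟩, rfl⟩
  have h1 := Set.ncard_le_ncard hsub ((hX.sdiff).image f)
  have h2 := Set.ncard_image_le (f := f) (hX.sdiff (t := {a}))
  have h3 := Set.ncard_sdiff_singleton_lt_of_mem ha hX
  omega

lemma factorAt_cons_zero {A : Type*} (c : A) (s : Stream' A) (m : ℕ) :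
    factorAt (Stream'.cons c s) 0 (m + 1) = c :: factorAt s 0 m := by
  simp [factorAt]

lemma factorAt_cons_succ {A : Type*} (c : A) (s : Stream' A) (i m : ℕ) :
    factorAt (Stream'.cons c s) (i + 1) m = factorAt s i m := by
  simp [factorAt, Stream'.drop_succ]

/-- Prepending `c` loses no factor, and both words have the same complexity, so it creates none
either. Thus every prefix is left special. -/
lemma IsStandardSturmian.cons_mem {s : Stream' Bool} (h : IsStandardSturmian s) (c : Bool)
    (m : ℕ) : c :: factorAt s 0 m ∈ factorsOfLength s (m + 1) := by
  have hc : IsSturmian (Stream'.cons c s) := by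
    cases c
    exacts [h.2.1, h.2.2]
  have hsub : factorsOfLength s (m + 1) ⊆ factorsOfLength (Stream'.cons c s) (m + 1) := by
    rintro _ ⟨i, rfl⟩
    exact ⟨i + 1, (factorAt_cons_succ c s i (m + 1)).symm⟩
  rw [Set.eq_of_subset_of_ncard_le hsub (by rw [hc, h.1]) (finite_factorsOfLength _ _),
    ← factorAt_cons_zero]
  exact factorAt_mem _ _ _

/-- If every prefix can be extended to the left, then every factor can. -/
lemma factorsOfLength_subset_image_tail {A : Type*} {s : Stream' A} {m : ℕ} {c : A}
    (h : c :: factorAt s 0 m ∈ factorsOfLength s (m + 1)) :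
    factorsOfLength s m ⊆ List.tail '' factorsOfLength s (m + 1) := by
  rintro _ ⟨i, rfl⟩
  cases i with
  | zero => exact ⟨_, h, rfl⟩
  | succ i => exact ⟨_, factorAt_mem s i (m + 1), by rw [factorAt_succ, List.tail_cons, factorAt]⟩

/-- Left special factors of a standard Sturmian word are prefixes. -/
lemma IsStandardSturmian.eq_prefix_of_left_special {s : Stream' Bool} (h : IsStandardSturmian s)
    {i j m : ℕ} (heq : factorAt s (i + 1) m = factorAt s (j + 1) m) (hne : s.get i ≠ s.get j) :
    factorAt s (i + 1) m = factorAt s 0 m := by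
  have := Set.apply_eq_apply_of_ncard_eq_add_one List.tail (finite_factorsOfLength s (m + 1))
    (factorsOfLength_subset_image_tail (h.cons_mem true m)) (by rw [h.1, h.1])
    (factorAt_mem s i (m + 1)) (factorAt_mem s j (m + 1)) (h.cons_mem true m) (h.cons_mem false m)
    (by simp [factorAt_succ, hne]) (by simp) (by simp [factorAt_succ, heq]) rfl
  simpa [factorAt_succ] using this

/-- A Sturmian word has at most one right special factor of each length. -/
lemma IsSturmian.right_special_unique {s : Stream' Bool} (h : IsSturmian s)
    {a a' b b' m : ℕ} (ha : factorAt s a m = factorAt s a' m)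
    (hb : factorAt s b m = factorAt s b' m) (hane : s.get (a + m) ≠ s.get (a' + m))
    (hbne : s.get (b + m) ≠ s.get (b' + m)) : factorAt s a m = factorAt s b m := by
  have key : ∀ i j, s.get (i + m) ≠ s.get (j + m) → factorAt s i (m + 1) ≠ factorAt s j (m + 1) :=
    fun i j hij heq => hij ((factorAt_eq_iff _ _ _ _ _).1 heq m (Nat.lt_succ_self m))
  have := Set.apply_eq_apply_of_ncard_eq_add_one List.dropLast (finite_factorsOfLength s (m + 1))
    (Y := factorsOfLength s m)
    (by
      rintro _ ⟨i, rfl⟩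
      exact ⟨_, factorAt_mem s i (m + 1), dropLast_factorAt s i m⟩)
    (by rw [h, h]) (factorAt_mem s a (m + 1)) (factorAt_mem s a' (m + 1))
    (factorAt_mem s b (m + 1)) (factorAt_mem s b' (m + 1)) (key _ _ hane) (key _ _ hbne)
    (by rw [dropLast_factorAt, dropLast_factorAt, ha])
    (by rw [dropLast_factorAt, dropLast_factorAt, hb])
  rwa [dropLast_factorAt, dropLast_factorAt] at this

lemma factorAt_succ_inj {A : Type*} {s : Stream' A} {i j m : ℕ}
    (h : factorAt s i m = factorAt s j m) (hm : s.get (i + m) = s.get (j + m)) :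
    factorAt s (i + 1) m = factorAt s (j + 1) m := by
  rw [factorAt_eq_iff] at h ⊢
  intro k hk
  rcases (Nat.succ_le_of_lt hk).lt_or_eq with hlt | rfl
  · simpa [Nat.add_assoc, Nat.add_comm 1] using h (k + 1) hlt
  · simpa [Nat.add_assoc, Nat.add_comm 1] using hm

lemma factorAt_add_one_inj {A : Type*} {s : Stream' A} {i j m : ℕ}
    (h : factorAt s i m = factorAt s j m) (hm : s.get (i + m) = s.get (j + m)) :
    factorAt s i (m + 1) = factorAt s j (m + 1) := by
  rw [factorAt_eq_iff] at h ⊢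
  intro k hk
  rcases (Nat.le_of_lt_succ hk).lt_or_eq with hlt | rfl
  · exact h k hlt
  · exact hm

/-- When the first return of the prefixes of a standard Sturmian word jumps, the new return is
determined by the length of the prefix. -/
lemma IsStandardSturmian.firstReturn_eq {s : Stream' Bool} (h : IsStandardSturmian s)
    {l p p' : ℕ} (hp : IsFirstReturn s l p) (hp' : IsFirstReturn s (l + 1) p') (hlt : p < p') :
    p' = l + 2 := by
  set F : ℕ → List Bool := fun t => factorAt s t (l + 1) with hF
  have hbreak : s.get (p + l) ≠ s.get (0 + l) := by
    intro heq
    exact hp'.2.2 p hp.1 hlt (factorAt_add_one_inj hp.2.1 heq)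
  -- Shift a repetition to the left: if the preceding letters differ, the window is left special,
  -- hence a prefix returning too early.
  have hinj : ∀ i j, i < j → j < p' → F i ≠ F j := by
    intro i
    induction i with
    | zero => exact fun j hj hjp heq => hp'.2.2 j hj hjp heq.symm
    | succ i ih =>
      intro j hij hjp heq
      obtain ⟨j, rfl⟩ : ∃ j', j = j' + 1 := ⟨j - 1, by omega⟩
      by_cases hc : s.get i = s.get j
      · refine ih j (by omega) (by omega) ?_
        have : factorAt s (i + 1) l = factorAt s (j + 1) l := factorAt_eq_of_le (Nat.le_succ l) heq
        simp [hF, factorAt_succ, hc, this]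
      · have := h.eq_prefix_of_left_special heq hc
        exact hp'.2.2 (i + 1) (by omega) (by omega) this
  have hsurj : ∀ t, ∃ i < p', F t = F i := by
    intro t
    induction t with
    | zero => exact ⟨0, hp'.1, rfl⟩
    | succ t ih =>
      obtain ⟨i, hi, hti⟩ := ih
      by_cases hc : s.get (t + (l + 1)) = s.get (i + (l + 1))
      · have hstep : F (t + 1) = F (i + 1) := factorAt_succ_inj hti hc
        rcases (Nat.succ_le_of_lt hi).lt_or_eq with hi' | hi'
        · exact ⟨i + 1, hi', hstep⟩
        · exact ⟨0, hp'.1, hstep.trans ((congrArg F hi').trans hp'.2.1)⟩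
      -- The overlap of the two windows is right special, hence the prefix of length l; its two
      -- extensions already occur at positions 0 and p.
      · have hu : factorAt s (t + 1) l = factorAt s p l := by
          refine h.1.right_special_unique (a' := i + 1) (b' := 0) ?_ hp.2.1 ?_ hbreak
          · have := congrArg List.tail hti
            simpa [hF, factorAt_succ] using this
          · rwa [Nat.add_assoc, Nat.add_comm 1, Nat.add_assoc, Nat.add_comm 1]
        have hext : ∀ j, s.get (t + 1 + l) = s.get (j + l) →
            factorAt s j l = factorAt s p l → F (t + 1) = F j :=
          fun j hj hjp => factorAt_add_one_inj (hu.trans hjp.symm) hj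
        by_cases hx : s.get (t + 1 + l) = s.get (p + l)
        · exact ⟨p, hlt, hext p hx rfl⟩
        · refine ⟨0, hp'.1, hext 0 ?_ hp.2.1.symm⟩
          revert hx hbreak
          generalize s.get (t + 1 + l) = x
          generalize s.get (p + l) = y
          generalize s.get (0 + l) = z
          revert x y z
          decide
  have himage : factorsOfLength s (l + 1) = ((Finset.range p').image F : Finset (List Bool)) := by
    ext u
    simp only [Finset.coe_image, Finset.coe_range, Set.mem_image, Set.mem_Iio]
    constructor
    · rintro ⟨t, rfl⟩
      obtain ⟨i, hi, hti⟩ := hsurj t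
      exact ⟨i, hi, hti.symm⟩
    · rintro ⟨i, -, rfl⟩
      exact factorAt_mem _ _ _
  have hcard := h.1 (l + 1)
  rw [himage, Set.ncard_coe_finset, Finset.card_image_of_injOn, Finset.card_range] at hcard
  · exact hcard
  · intro i hi j hj hij
    simp only [Finset.coe_range, Set.mem_Iio] at hi hj
    rcases lt_trichotomy i j with hlt | heq | hlt
    · exact absurd hij (hinj i j hlt hj)
    · exact heq
    · exact absurd hij.symm (hinj j i hlt hi)

/-! ### Sufficient conditions for being standard. -/

lemma factorsOfLength_cons {A : Type*} {s : Stream' A} {c : A}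
    (h : ∀ m, c :: factorAt s 0 m ∈ factorsOfLength s (m + 1)) (m : ℕ) :
    factorsOfLength (Stream'.cons c s) m = factorsOfLength s m := by
  apply Set.Subset.antisymm
  · rintro _ ⟨i, rfl⟩
    cases i with
    | zero =>
      cases m with
      | zero => exact ⟨0, rfl⟩
      | succ m =>
        change factorAt (Stream'.cons c s) 0 (m + 1) ∈ _
        rw [factorAt_cons_zero]
        exact h m
    | succ i => exact ⟨i, factorAt_cons_succ c s i m⟩
  · rintro _ ⟨i, rfl⟩
    exact ⟨i + 1, (factorAt_cons_succ c s i m).symm⟩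

/-- A word all of whose prefixes are left special is standard Sturmian as soon as its complexity
is small infinitely often. -/
lemma isStandardSturmian_of_cons_mem {s : Stream' Bool}
    (hcons : ∀ c m, c :: factorAt s 0 m ∈ factorsOfLength s (m + 1))
    (hcard : ∀ N, ∃ m ≥ N, (factorsOfLength s m).ncard ≤ m + 1) : IsStandardSturmian s := by
  have hstep : ∀ m, (factorsOfLength s m).ncard < (factorsOfLength s (m + 1)).ncard := fun m =>
    Set.ncard_lt_ncard_of_surjOn_of_eq List.tail (finite_factorsOfLength s (m + 1))
      (factorsOfLength_subset_image_tail (hcons true m)) (hcons true m) (hcons false m)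
      (by simp) rfl
  have hadd : ∀ m d, (factorsOfLength s m).ncard + d ≤ (factorsOfLength s (m + d)).ncard := by
    intro m d
    induction d with
    | zero => simp
    | succ d ih =>
      have := hstep (m + d)
      rw [← Nat.add_assoc m d 1]
      omega
  have hzero : 0 < (factorsOfLength s 0).ncard :=
    (Set.ncard_pos (finite_factorsOfLength s 0)).2 ⟨_, factorAt_mem s 0 0⟩
  have hs : IsSturmian s := by
    intro m
    obtain ⟨M, hM, hle⟩ := hcard m
    obtain ⟨d, rfl⟩ := Nat.exists_eq_add_of_le hM
    -- Complexity grows by at least one per step, so the lower bound at m and the upper bound at M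
    -- leave only m + 1.
    have h1 := hadd m d
    have h2 := hadd 0 m
    rw [Nat.zero_add] at h2
    omega
  refine ⟨hs, ?_, ?_⟩ <;>
  · intro m
    rw [factorsOfLength_cons (hcons _), hs]

/-- A word with a suitable infinite sequence of periodic prefixes is standard Sturmian. -/
lemma isStandardSturmian_of_periods {s : Stream' Bool} {p : ℕ → ℕ} (hp : StrictMono p)
    (hpos : 0 < p 0) (hper : ∀ j i, i + 2 < p (j + 1) → s.get (i + p j) = s.get i)
    (hne : ∀ j, s.get (p j - 1) ≠ s.get (p (j + 1) - 1)) : IsStandardSturmian s := by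
  have hppos : ∀ j, 0 < p j := fun j => hpos.trans_le (hp.monotone (Nat.zero_le j))
  apply isStandardSturmian_of_cons_mem
  · intro c m
    have hocc : ∀ j, m + 2 ≤ p (j + 1) →
        s.get (p j - 1) :: factorAt s 0 m ∈ factorsOfLength s (m + 1) := by
      intro j hj
      refine ⟨p j - 1, ?_⟩
      change _ = factorAt s (p j - 1) (m + 1)
      rw [factorAt_succ, Nat.sub_add_cancel (hppos j)]
      congr 1
      rw [factorAt_eq_iff]
      intro k hk
      rw [Nat.zero_add, Nat.add_comm, hper j k (by omega)]
    have h1 := hocc (m + 1) (hp.le_apply)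
    have h2 := hocc (m + 2) (le_trans (Nat.le_succ _) hp.le_apply)
    have h3 := hne (m + 1)
    revert h1 h2 h3
    rw [Nat.add_assoc m 1 1]
    generalize s.get (p (m + 1) - 1) = x
    generalize s.get (p (m + (1 + 1)) - 1) = y
    cases c <;> cases x <;> cases y <;> simp_all
  · intro N
    refine ⟨p (N + 1) - 1, ?_, ?_⟩
    · have : N + 1 ≤ p (N + 1) := hp.le_apply
      omega
    generalize N + 1 = j
    rw [Nat.sub_add_cancel (hppos j)]
    have hsurj : ∀ t, ∃ i < p j, factorAt s t (p j - 1) = factorAt s i (p j - 1) := by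
      intro t
      induction t using Nat.strong_induction_on with
      | _ t ih =>
        rcases Nat.lt_or_ge t (p j) with ht | ht
        · exact ⟨t, ht, rfl⟩
        -- Choose i with `p i ≤ t < p (i + 1)`; the window then lies where the period `p i` is
        -- valid, and shifts left by `p i`.
        have hex : ∃ i, t < p i := ⟨t + 1, hp.le_apply⟩
        obtain ⟨i, hi⟩ : ∃ i, Nat.find hex = i + 1 := by
          refine Nat.exists_eq_succ_of_ne_zero fun h0 => ?_
          have := Nat.find_spec hex
          rw [h0] at this
          have := hp.monotone (Nat.zero_le j)
          omega
        have hi1 : t < p (i + 1) := hi ▸ Nat.find_spec hex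
        have hi2 : p i ≤ t := not_lt.1 (Nat.find_min hex (by omega))
        have hji : p j ≤ p i := hp.monotone (Nat.le_of_lt_succ (hp.lt_iff_lt.1 (ht.trans_lt hi1)))
        have := hppos j
        obtain ⟨a, ha, hta⟩ := ih (t - p i) (by omega)
        refine ⟨a, ha, Eq.trans ?_ hta⟩
        rw [factorAt_eq_iff]
        intro k hk
        rw [← hper i (t - p i + k) (by omega)]
        congr 1
        omega
    have hsub : factorsOfLength s (p j - 1) ⊆
        ((Finset.range (p j)).image fun i => factorAt s i (p j - 1) : Finset (List Bool)) := by
      rintro _ ⟨t, rfl⟩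
      obtain ⟨i, hi, hti⟩ := hsurj t
      simp only [Finset.coe_image, Finset.coe_range]
      exact ⟨i, hi, hti.symm⟩
    refine (Set.ncard_le_ncard hsub (Finset.finite_toSet _)).trans ?_
    rw [Set.ncard_coe_finset]
    exact Finset.card_image_le.trans (Finset.card_range _).le

/-! ### Central pairs and their limit. -/

/-- The word `f` has period `q`, and its prefix of length `p + q - 2` has period `p`, where neither
period extends to the left. -/
structure IsCentralPair (f : ℕ → Bool) (p q : ℕ) : Prop where
  pos : 0 < p
  lt : p < q
  periodic : ∀ i, f (i + q) = f i
  prefix_periodic : ∀ i, i + 2 < q → f (i + p) = f i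
  ne : f (p - 1) ≠ f (q - 1)

/-- The periodic word generated by the prefix of length `p + q`. -/
def centralExtend (x : (ℕ → Bool) × ℕ × ℕ) : (ℕ → Bool) × ℕ × ℕ :=
  (fun i => x.1 (i % (x.2.1 + x.2.2)), x.2.2, x.2.1 + x.2.2)

/-- Beyond p + q, the old word itself repeats with shift p + q as long as its prefix period p lasts:
shift by q, then by p. -/
lemma centralExtend_apply {x : (ℕ → Bool) × ℕ × ℕ} (h : IsCentralPair x.1 x.2.1 x.2.2) {i : ℕ}
    (hi : i + 2 < x.2.1 + x.2.2 + x.2.2 ∨ i < x.2.1 + x.2.2) : (centralExtend x).1 i = x.1 i := by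
  obtain ⟨f, p, q⟩ := x
  have hlt := h.lt
  simp only [centralExtend] at *
  rcases Nat.lt_or_ge i (p + q) with hc | hc
  · rw [Nat.mod_eq_of_lt hc]
  · obtain ⟨k, rfl⟩ := Nat.exists_eq_add_of_le hc
    have e : p + q + k = k + p + q := by omega
    rw [Nat.add_mod_left, Nat.mod_eq_of_lt (by omega), e, h.periodic,
      h.prefix_periodic k (by omega)]

lemma IsCentralPair.extend {x : (ℕ → Bool) × ℕ × ℕ} (h : IsCentralPair x.1 x.2.1 x.2.2) :
    IsCentralPair (centralExtend x).1 (centralExtend x).2.1 (centralExtend x).2.2 := by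
  have happ := @centralExtend_apply x h
  obtain ⟨f, p, q⟩ := x
  replace h : IsCentralPair f p q := h
  have hpos := h.pos
  have hlt := h.lt
  refine ⟨?_, ?_, ?_, ?_, ?_⟩
  · simp only [centralExtend]
    omega
  · simp only [centralExtend]
    omega
  · intro i
    simp [centralExtend]
  · intro i hi
    simp only [centralExtend] at hi
    change (centralExtend (f, p, q)).1 (i + q) = _
    rw [happ (Or.inl (by simp only; omega)), happ (Or.inl (by simp only; omega))]
    exact h.periodic i
  · change (centralExtend (f, p, q)).1 (q - 1) ≠ (centralExtend (f, p, q)).1 (p + q - 1)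
    rw [happ (Or.inr (by simp only; omega)), happ (Or.inr (by simp only; omega))]
    -- Modulo the period q, the two letters to compare are the old ones in swapped order.
    have e : p + q - 1 = p - 1 + q := by omega
    rw [e]
    change f (q - 1) ≠ f (p - 1 + q)
    rw [h.periodic]
    exact h.ne.symm

/-- A long prefix of the periodic word of a central pair is a prefix of a standard Sturmian word. -/
lemma IsCentralPair.exists_standard {f : ℕ → Bool} {p q : ℕ} (h : IsCentralPair f p q) :
    ∃ s : Stream' Bool, IsStandardSturmian s ∧ ∀ i, i + 2 < p + q + q → s.get i = f i := by
  set x : ℕ → (ℕ → Bool) × ℕ × ℕ := fun j => centralExtend^[j] (f, p, q) with hx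
  have hsucc : ∀ j, x (j + 1) = centralExtend (x j) := fun j =>
    Function.iterate_succ_apply' centralExtend j (f, p, q)
  have hpair : ∀ j, IsCentralPair (x j).1 (x j).2.1 (x j).2.2 := by
    intro j
    induction j with
    | zero => exact h
    | succ j ih =>
      rw [hsucc]
      exact ih.extend
  have hq : ∀ j, (x (j + 1)).2.1 = (x j).2.2 := fun j => by rw [hsucc]; rfl
  have hq' : ∀ j, (x (j + 1)).2.2 = (x j).2.1 + (x j).2.2 := fun j => by rw [hsucc]; rfl
  have hmono : StrictMono fun j => (x j).2.1 :=
    strictMono_nat_of_lt_succ fun j => by rw [hq]; exact (hpair j).lt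
  have hle : ∀ j, j ≤ (x j).2.1 := fun j => hmono.le_apply
  have hagree : ∀ j d i, i < (x j).2.1 + (x j).2.2 → (x (j + d)).1 i = (x j).1 i := by
    intro j d i hi
    induction d with
    | zero => rfl
    | succ d ih =>
      rw [← Nat.add_assoc, hsucc, centralExtend_apply (hpair _), ih]
      right
      have h1 := hmono.monotone (Nat.le_add_right j d)
      have h2 := hmono.monotone (Nat.le_add_right (j + 1) d)
      rw [Nat.add_right_comm] at h2
      simp only [hq] at h1 h2
      omega
  -- The diagonal is the limit: letter i is already final at stage i, because the smaller period
  -- there is at least i.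
  set s : Stream' Bool := fun i => (x i).1 i with hs
  have hsx : ∀ j i, i < (x j).2.1 + (x j).2.2 → s.get i = (x j).1 i := by
    intro j i hi
    change (x i).1 i = _
    rcases le_total i j with hij | hij
    · obtain ⟨d, rfl⟩ := Nat.exists_eq_add_of_le hij
      have h1 := hle i
      have h2 := (hpair i).lt
      exact (hagree i d i (by omega)).symm
    · obtain ⟨d, rfl⟩ := Nat.exists_eq_add_of_le hij
      exact hagree j d _ hi
  refine ⟨s, isStandardSturmian_of_periods hmono h.pos ?_ ?_, ?_⟩
  · intro j i hi
    simp only [hq] at hi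
    have h1 := (hpair j).lt
    rw [hsx j _ (by omega), hsx j _ (by omega)]
    exact (hpair j).prefix_periodic i hi
  · intro j
    have h1 := (hpair j).lt
    have h2 := (hpair j).pos
    simp only [hq]
    rw [hsx j _ (by omega), hsx j _ (by omega)]
    exact (hpair j).ne
  · intro i hi
    have hlt := h.lt
    rw [hsx 1 i, hsucc, centralExtend_apply (hpair 0) (Or.inl hi)]
    · rfl
    · rw [hq, hq']
      change i < q + (p + q)
      omega

/-- The two periods given by a jump of the first return do not extend to the left. -/
lemma IsFirstReturn.get_ne {A : Type*} {s : Stream' A} {e p : ℕ} (hp : IsFirstReturn s e p)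
    (hq : IsFirstReturn s (e + 1) (e + 2)) (hlt : p < e + 2) :
    s.get (p - 1) ≠ s.get (e + 1) := by
  intro heq
  have hpos := hp.1
  -- If the letters agreed, both periods would extend one place to the left, giving a word of length
  -- p + e + 1, just enough for Fine and Wilf.
  set t : Stream' A := Stream'.cons (s.get (p - 1)) s with ht
  have ht0 : t.get 0 = s.get (p - 1) := rfl
  have hts : ∀ i, t.get (i + 1) = s.get i := fun i => rfl
  have htp : t.get p = s.get (p - 1) := by
    rw [← hts, Nat.sub_add_cancel hpos]
  have hsp : ∀ i < e, s.get (p + i) = s.get i := fun i hi => by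
    simpa using (factorAt_eq_iff _ _ _ _ _).1 hp.2.1 i hi
  have hsq : ∀ i < e + 1, s.get (e + 2 + i) = s.get i := fun i hi => by
    simpa using (factorAt_eq_iff _ _ _ _ _).1 hq.2.1 i hi
  have hget : ∀ i < p + e + 1, (factorAt t 0 (p + e + 1))[i]? = some (t.get i) := by
    intro i hi
    rw [getElem?_factorAt t hi, Nat.zero_add]
  have per_p : List.HasPeriod (factorAt t 0 (p + e + 1)) p := by
    rw [List.hasPeriod_iff_getElem?, length_factorAt]
    intro i hi
    rw [hget _ (by omega), hget _ (by omega)]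
    cases i with
    | zero => rw [Nat.zero_add, htp, ht0]
    | succ i => rw [Nat.add_right_comm, hts, hts, Nat.add_comm i p, hsp i (by omega)]
  have per_q : List.HasPeriod (factorAt t 0 (p + e + 1)) (e + 2) := by
    rw [List.hasPeriod_iff_getElem?, length_factorAt]
    intro i hi
    rw [hget _ (by omega), hget _ (by omega)]
    cases i with
    | zero => rw [Nat.zero_add, hts, ht0, heq]
    | succ i => rw [Nat.add_right_comm, hts, hts, Nat.add_comm i, hsq i (by omega)]
  have hdpos : 0 < p.gcd (e + 2) := Nat.gcd_pos_of_pos_left _ hpos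
  have per_d := per_p.gcd per_q (by rw [length_factorAt]; omega)
  rcases (Nat.gcd_le_left (e + 2) hpos).lt_or_eq with hd | hd
  -- A gcd below p would be an earlier return.
  · refine hp.2.2 _ hdpos hd ((factorAt_eq_iff _ _ _ _ _).2 fun k hk => ?_)
    rw [List.hasPeriod_iff_getElem?, length_factorAt] at per_d
    have := per_d (k + 1) (by omega)
    rw [hget _ (by omega), hget _ (by omega), Nat.add_right_comm, hts, hts, Option.some_inj] at this
    rw [Nat.zero_add, Nat.add_comm, this]
  -- If p divides e + 2, both periods together force the match at p to last one letter longer, so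
  -- length e + 1 would already return at p.
  · obtain ⟨c, hc⟩ := Nat.gcd_eq_left_iff_dvd.1 hd
    have hmod : (e + 1) % p = p - 1 := by
      obtain ⟨c, rfl⟩ : ∃ c', c = c' + 1 :=
        Nat.exists_eq_succ_of_ne_zero (by rintro rfl; simp at hc)
      have : e + 1 = p - 1 + p * c := by
        rw [Nat.mul_succ] at hc
        omega
      rw [this, Nat.add_mul_mod_self_left, Nat.mod_eq_of_lt (by omega)]
    have h1 := per_p.getElem?_mod p (e + 1) _ (by rw [length_factorAt]; omega)
    rw [hmod, hget _ (by omega), hget _ (by omega), Option.some_inj, hts] at h1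
    have h2 : s.get (p + e) = t.get (p - 1) := by
      obtain rfl | ⟨a, rfl⟩ : p = 1 ∨ ∃ a, p = a + 2 := by
        rcases Nat.lt_or_ge p 2 with h | h
        · exact Or.inl (by omega)
        · exact Or.inr ⟨p - 2, by omega⟩
      · rw [Nat.sub_self, ht0, heq, Nat.add_comm]
      · rw [show a + 2 - 1 = a + 1 by omega, hts, ← hsq a (by omega)]
        congr 1
        omega
    refine hq.2.2 p hpos hlt (factorAt_add_one_inj hp.2.1 ?_)
    rw [h2, h1, Nat.zero_add]

lemma isPrefixOfInfinite_iff {A : Type*} (w : List A) (s : Stream' A) :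
    IsPrefixOfInfinite w s ↔ ∀ i < w.length, w[i]? = some (s.get i) := by
  rw [IsPrefixOfInfinite, take_eq_factorAt]
  constructor
  · intro h i hi
    conv_lhs => rw [h]
    rw [getElem?_factorAt s hi, Nat.zero_add]
  · intro h
    apply List.ext_getElem?
    intro i
    by_cases hi : i < w.length
    · rw [h i hi, getElem?_factorAt s hi, Nat.zero_add]
    · rw [List.getElem?_eq_none, List.getElem?_eq_none]
      · rw [length_factorAt]
        omega
      · omega

lemma exists_isPrefixOfInfinite {A : Type*} [Inhabited A] (w : List A) :
    ∃ s : Stream' A, IsPrefixOfInfinite w s := by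
  refine ⟨fun i => w.getD i default, (isPrefixOfInfinite_iff _ _).2 fun i hi => ?_⟩
  change w[i]? = some (w.getD i default)
  simp [hi]

/-- A word of length `2 * e + 3` whose first returns jump to `e + 2` is a prefix of a standard
Sturmian word. -/
lemma exists_standard_of_isFirstReturn {w : List Bool} {t : Stream' Bool} {e p : ℕ}
    (hw : IsPrefixOfInfinite w t) (hlen : w.length = 2 * e + 3) (hp : IsFirstReturn t e p)
    (hq : IsFirstReturn t (e + 1) (e + 2)) (hlt : p < e + 2) :
    ∃ s : Stream' Bool, IsStandardSturmian s ∧ IsPrefixOfInfinite w s := by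
  have hpos := hp.1
  set f : ℕ → Bool := fun i => t.get (i % (e + 2)) with hf
  have hft : ∀ i < 2 * e + 3, f i = t.get i := by
    -- The return of length e + 1 at e + 2 spans exactly 2e + 3 letters, all of w.
    intro i hi
    simp only [hf]
    rcases Nat.lt_or_ge i (e + 2) with h | h
    · rw [Nat.mod_eq_of_lt h]
    · obtain ⟨k, rfl⟩ := Nat.exists_eq_add_of_le h
      rw [Nat.add_mod_left, Nat.mod_eq_of_lt (by omega)]
      have := (factorAt_eq_iff _ _ _ _ _).1 hq.2.1 k (by omega)
      rw [this, Nat.zero_add]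
  have hc : IsCentralPair f p (e + 2) := by
    refine ⟨hpos, hlt, fun i => by simp [hf], fun i hi => ?_, ?_⟩
    · rw [hft _ (by omega), hft _ (by omega), Nat.add_comm i p]
      simpa using (factorAt_eq_iff _ _ _ _ _).1 hp.2.1 i (by omega)
    · rw [hft _ (by omega), hft _ (by omega)]
      exact hp.get_ne hq hlt
  obtain ⟨s, hs, hsf⟩ := hc.exists_standard
  refine ⟨s, hs, (isPrefixOfInfinite_iff _ _).2 fun i hi => ?_⟩
  rw [hsf i (by omega), hft i (by omega)]
  exact (isPrefixOfInfinite_iff _ _).1 hw i hi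

/-! ### Reading returns off the blocks. -/

/-- The concatenation of the blocks `1 ^ k i 0 ^ k' i` for `i < j`. -/
def ocBlocks (k k' : ℕ → ℕ) (j : ℕ) : List (Fin 2) :=
  (List.range j).flatMap fun i => List.replicate (k i) 1 ++ List.replicate (k' i) 0

lemma ocBlocks_succ (k k' : ℕ → ℕ) (j : ℕ) :
    ocBlocks k k' (j + 1) =
      ocBlocks k k' j ++ (List.replicate (k j) 1 ++ List.replicate (k' j) 0) := by
  simp [ocBlocks, List.range_succ, List.flatMap_append]

lemma count_one_ocBlocks (k k' : ℕ → ℕ) (j : ℕ) :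
    (ocBlocks k k' j).count 1 = ∑ i ∈ Finset.range j, k i := by
  induction j with
  | zero => simp [ocBlocks]
  | succ j ih => simp [ocBlocks_succ, ih, Finset.sum_range_succ, List.count_replicate]

lemma count_zero_ocBlocks (k k' : ℕ → ℕ) (j : ℕ) :
    (ocBlocks k k' j).count 0 = ∑ i ∈ Finset.range j, k' i := by
  induction j with
  | zero => simp [ocBlocks]
  | succ j ih => simp [ocBlocks_succ, ih, Finset.sum_range_succ, List.count_replicate]

lemma length_ocBlocks (k k' : ℕ → ℕ) (j : ℕ) :
    (ocBlocks k k' j).length = ∑ i ∈ Finset.range j, k i + ∑ i ∈ Finset.range j, k' i := by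
  induction j with
  | zero => simp [ocBlocks]
  | succ j ih =>
    simp only [ocBlocks_succ, List.length_append, List.length_replicate, ih,
      Finset.sum_range_succ]
    omega

/-- Every block is followed by a 1: the first letter of the next block, or the final letter.
Induction on the number `d` of blocks that remain. -/
lemma ocBlocks_append_one {k k' : ℕ → ℕ} {n : ℕ} (hk : ∀ j ≤ n, 0 < k j) (d : ℕ) :
    ∀ j, j + d = n → ∃ v, ocBlocks k k' (n + 1) ++ [1] = ocBlocks k k' (j + 1) ++ 1 :: v := by
  induction d with
  | zero =>
    rintro j rfl
    exact ⟨[], rfl⟩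
  | succ d ih =>
    intro j hj
    obtain ⟨v, hv⟩ := ih (j + 1) (by omega)
    obtain ⟨c, hc⟩ := Nat.exists_eq_succ_of_ne_zero (hk (j + 1) (by omega)).ne'
    rw [hv, ocBlocks_succ _ _ (j + 1), hc]
    refine ⟨List.replicate c 1 ++ (List.replicate (k' (j + 1)) 0 ++ 1 :: v), ?_⟩
    simp only [List.replicate_succ, List.append_assoc, List.cons_append]

/-- The first returns read off at the last `1` of a block and at the next `1`. -/
lemma isFirstReturn_of_ocBlocks {A : Type*} {w : List A} {s : Stream' A} {n : ℕ} {k k' : ℕ → ℕ}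
    (hk : ∀ j ≤ n, 0 < k j) (hw : ocSeq w = ocBlocks k k' (n + 1) ++ [1])
    (hs : IsPrefixOfInfinite w s) {j : ℕ} (hj : j ≤ n) :
    IsFirstReturn s (∑ i ∈ Finset.range (j + 1), k i - 1) (∑ i ∈ Finset.range j, k' i + 1) ∧
      IsFirstReturn s (∑ i ∈ Finset.range (j + 1), k i) (∑ i ∈ Finset.range (j + 1), k' i + 1) := by
  obtain ⟨v, hv⟩ := ocBlocks_append_one (k' := k') hk (n - j) j (by omega)
  rw [hv] at hw
  have h2 := isFirstReturn_of_ocSeq hs hw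
  rw [count_one_ocBlocks, count_zero_ocBlocks] at h2
  obtain ⟨c, hc⟩ := Nat.exists_eq_succ_of_ne_zero (hk j hj).ne'
  have hw' : ocSeq w =
      (ocBlocks k k' j ++ List.replicate c 1) ++ 1 :: (List.replicate (k' j) 0 ++ 1 :: v) := by
    rw [hw, ocBlocks_succ, hc, Nat.succ_eq_add_one, List.replicate_succ']
    simp
  have h1 := isFirstReturn_of_ocSeq hs hw'
  rw [List.count_append, List.count_append, count_one_ocBlocks, count_zero_ocBlocks] at h1
  refine ⟨?_, h2⟩
  rw [Finset.sum_range_succ, hc]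
  simpa [List.count_replicate] using h1

theorem mainTheorem5 (w : List Bool) (n : ℕ) (k k' : ℕ → ℕ)
    (hk : ∀ j ≤ n, 0 < k j) (hk' : ∀ j ≤ n, 0 < k' j)
    (hw : ocSeq w =
      ((List.range (n + 1)).flatMap fun j =>
        List.replicate (k j) 1 ++ List.replicate (k' j) 0) ++ [1]) :
    (∃ s : Stream' Bool, IsStandardSturmian s ∧ IsPrefixOfInfinite w s) ↔
      ∀ j ≤ n, k j = k' j := by
  change ocSeq w = ocBlocks k k' (n + 1) ++ [1] at hw
  constructor
  · rintro ⟨s, hs, hws⟩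
    have hsum : ∀ j ≤ n,
        ∑ i ∈ Finset.range (j + 1), k i = ∑ i ∈ Finset.range (j + 1), k' i := by
      intro j hj
      obtain ⟨h1, h2⟩ := isFirstReturn_of_ocBlocks hk hw hws hj
      have hkj := hk j hj
      have hkj' := hk' j hj
      have hpos : 1 ≤ ∑ i ∈ Finset.range (j + 1), k i := by
        rw [Finset.sum_range_succ]
        omega
      rw [← Nat.sub_add_cancel hpos] at h2
      -- The jump is strict because `k' j` is positive.
      have := hs.firstReturn_eq h1 h2 (by rw [Finset.sum_range_succ]; omega)
      omega
    intro j hj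
    have h1 := hsum j hj
    rw [Finset.sum_range_succ, Finset.sum_range_succ] at h1
    cases j with
    | zero => simpa using h1
    | succ j =>
      have h0 := hsum j (by omega)
      omega
  · intro heq
    obtain ⟨t, ht⟩ := exists_isPrefixOfInfinite w
    -- Any infinite extension `t` of w serves to express the returns; only the last block is needed.
    obtain ⟨h1, h2⟩ := isFirstReturn_of_ocBlocks hk hw ht le_rfl
    have hsum : ∑ i ∈ Finset.range (n + 1), k' i = ∑ i ∈ Finset.range (n + 1), k i :=
      Finset.sum_congr rfl fun i hi => (heq i (by simpa [Nat.lt_succ_iff] using hi)).symm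
    have hlen : w.length = ∑ i ∈ Finset.range (n + 1), k i +
        ∑ i ∈ Finset.range (n + 1), k' i + 1 := by
      rw [← length_ocSeq w, hw, List.length_append, length_ocBlocks, List.length_singleton]
    rw [hsum] at h2 hlen
    have hlast : ∑ i ∈ Finset.range (n + 1), k' i = ∑ i ∈ Finset.range n, k' i + k' n :=
      Finset.sum_range_succ _ _
    have hkn := hk' n le_rfl
    obtain ⟨e, he⟩ : ∃ e, ∑ i ∈ Finset.range (n + 1), k i = e + 1 :=
      Nat.exists_eq_succ_of_ne_zero (by omega)
    rw [he] at h1 h2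
    exact exists_standard_of_isFirstReturn ht (by omega) h1 h2 (by omega)
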